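/- All rings are associative and unital. For a ring $R$ let $J(R)$ be its Jacobson radical, $U(R)$ its group of units, and $$\Delta(R)=\{x\in R : x+u\in U(R)\ \text{for all } u\in U(R)\}.$$ A ring $R$ is called SDT (strongly $\Delta$ tripotent) if every $a\in R$ can be written as $a=e+d$ with $e^3=e\in R$, $d\in\Delta(R)$ and $ed=de$. For $a,b\in R$ let $l_a-r_b:R\to R$ be the additive map $x\mapsto ax-xb$. A ring $R$ is local if $R/J(R)$ is a division ring, and a local ring $R$ is bleached if for all $a\in U(R)$ and $b\in J(R)$ both $l_a-r_b$ and $l_b-r_a$ are surjective. Let $T_n(R)$ denote the ring of upper triangular $n\times n$ matrices over $R$. **Theorem.** Let $R$ be a (not necessarily commutative) local ring and $n>2$ an integer. Then $T_n(R)$ is an SDT ring if and only if one of the following two conditions holds: 1. $R$ is bleached and $R/J(R)\cong\mathbb{Z}_2$; 2. $R$ is bleached, $R/J(R)\cong\mathbb{Z}_3$, and for all $a,b\in R$ with $a-1\in\Delta(R)$ and $b+1\in\Delta(R)$ the map $l_a-r_b:R\to R$ is surjective. Here $\mathbb{Z}_2$, $\mathbb{Z}_3$ are the rings of integers modulo $2$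 and $3$, and $\cong$ is isomorphism of rings. -/

import Mathlib

/-- `Δ(R) = {x ∈ R : x + u is a unit for every unit u of R}`. -/
def DeltaSet (R : Type*) [Ring R] : Set R :=
  {x | ∀ u : R, IsUnit u → IsUnit (x + u)}

/-- `R` is strongly `Δ` tripotent (SDT): every element is the sum of a tripotent and an element
of `Δ(R)` that commute with each other. -/
def IsSDTRing (R : Type*) [Ring R] : Prop :=
  ∀ a : R, ∃ e d : R, e ^ 3 = e ∧ d ∈ DeltaSet R ∧ e * d = d * e ∧ a = e + d

/-- The additive endomorphism `l_a - r_b : r ↦ a * r - r * b` of `R`. -/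
def leftSubRight {R : Type*} [Ring R] (a b : R) : R →+ R :=
  AddMonoidHom.mulLeft a - AddMonoidHom.mulRight b

/-- The bleached condition on a (local) ring: `l_a - r_b` and `l_b - r_a` are surjective for
every unit `a` and every `b` in the Jacobson radical. -/
def IsBleached (R : Type*) [Ring R] : Prop :=
  ∀ a b : R, IsUnit a → b ∈ Ring.jacobson R →
    Function.Surjective (leftSubRight a b) ∧ Function.Surjective (leftSubRight b a)

/-- The ring `T_n(R)` of upper triangular `n × n` matrices over `R`, as a subring of the full
matrix ring. -/
def upperTriangularRing (n : ℕ) (R : Type*) [Ring R] : Subring (Matrix (Fin n) (Fin n) R) where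
  __ := Matrix.blockTriangularSubsemiring R (id : Fin n → Fin n)
  neg_mem' hM := Matrix.BlockTriangular.neg hM

/-! In a local ring `Δ(R) = J(R)` is the set of nonunits, and an upper triangular matrix lies in `Δ`
iff its diagonal entries do. Necessity: put `a`, `b` on the diagonal and `r` in the corner. The
tripotent part commutes with this matrix, and the corner entry of that identity
(`exists_tripotents`) can be solved for `r` once the residues of `a` and `b` determine enough of its
diagonal. Tripotents have residue `0` or `±1`, whence `ZMod 2` or `ZMod 3`. Sufficiency:
surjectivity of `l_a - r_b` for distinct residues lets a unitriangular conjugation clear all entries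
between residue classes (`exists_unitriangular_conj`). The diagonal matrix of residues, lifted to
`0`, `±1`, then commutes with the result; conjugating it back gives the tripotent. -/

theorem leftSubRight_apply {R : Type*} [Ring R] (a b x : R) :
    leftSubRight a b x = a * x - x * b := rfl

theorem neg_mem_deltaSet {R : Type*} [Ring R] {x : R} (hx : x ∈ DeltaSet R) : -x ∈ DeltaSet R := by
  intro u hu
  have := (hx (-u) hu.neg).neg
  rwa [neg_add, neg_neg] at this

/-! ### Local rings: nonunits, `Δ` and tripotents -/

/-- In a local ring a one-sided factor of a unit is a unit. -/
theorem IsLocalRing.isUnit_of_mul_eq_one {R : Type*} [Ring R] [IsLocalRing R] {x z : R}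
    (h : z * x = 1) : IsUnit x := by
  -- An idempotent of a local ring is `0` or `1`.
  have hid : (x * z) * (x * z) = x * z := by
    rw [mul_assoc, ← mul_assoc z, h, one_mul]
  rcases IsLocalRing.isUnit_or_isUnit_of_add_one (a := x * z) (b := 1 - x * z) (by abel) with hu | hu
  · have : x * z = 1 := hu.mul_left_cancel (by rw [hid, mul_one])
    exact ⟨⟨x, z, this, h⟩, rfl⟩
  · have h0 : x * z = 0 := hu.mul_left_cancel (by rw [sub_mul, hid, one_mul, sub_self, mul_zero])
    have hx : x = 0 := by
      rw [← mul_one x, ← h, ← mul_assoc, h0, zero_mul]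
    rw [hx, mul_zero] at h
    exact absurd h zero_ne_one

theorem IsLocalRing.mem_ringJacobson_iff {R : Type*} [Ring R] [IsLocalRing R] {x : R} :
    x ∈ Ring.jacobson R ↔ ¬ IsUnit x := by
  rw [← Ideal.jacobson_bot]
  constructor
  · intro hx hu
    obtain ⟨u, rfl⟩ := hu
    obtain ⟨z, hz⟩ := Ideal.mem_jacobson_iff.1 hx (-(↑u⁻¹ : R))
    rw [mul_assoc, neg_mul, Units.inv_mul] at hz
    simp at hz
  · intro hx
    refine Ideal.mem_jacobson_iff.2 fun y => ?_
    have hyx : ¬ IsUnit (-(y * x)) := by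
      rintro hu
      obtain ⟨u, hu⟩ := IsUnit.neg_iff _ |>.1 hu
      exact hx (IsLocalRing.isUnit_of_mul_eq_one (z := ↑u⁻¹ * y)
        (by rw [mul_assoc, ← hu, Units.inv_mul]))
    obtain ⟨u, hu⟩ := (IsLocalRing.isUnit_or_isUnit_of_add_one
      (a := -(y * x)) (b := 1 + y * x) (by abel)).resolve_left hyx
    refine ⟨↑u⁻¹, ?_⟩
    have : (↑u⁻¹ : R) * (1 + y * x) = 1 := by rw [← hu, Units.inv_mul]
    rw [mul_add, mul_one] at this
    rw [Ideal.mem_bot, mul_assoc, add_comm, this, sub_self]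

theorem IsLocalRing.mem_deltaSet_iff {R : Type*} [Ring R] [IsLocalRing R] {x : R} :
    x ∈ DeltaSet R ↔ x ∈ Ring.jacobson R := by
  rw [IsLocalRing.mem_ringJacobson_iff]
  constructor
  · intro hx hu
    simpa using hx (-x) hu.neg
  · intro hx u hu
    by_contra h
    have hx' : -x ∈ nonunits R := fun h' => hx ((IsUnit.neg_iff _).1 h')
    refine IsLocalRing.nonunits_add hx' h ?_
    simpa using hu

theorem IsLocalRing.isUnit_of_sub_mem_ringJacobson {R : Type*} [Ring R] [IsLocalRing R] {x y : R}
    (h : x - y ∈ Ring.jacobson R) (hy : IsUnit y) : IsUnit x := by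
  simpa using IsLocalRing.mem_deltaSet_iff.2 h y hy

theorem pow_two_eq_one_of_isUnit_of_pow_three {R : Type*} [Ring R] {e : R} (he : e ^ 3 = e)
    (hu : IsUnit e) : e * e = 1 :=
  hu.mul_left_cancel (by rw [mul_one, ← pow_two, ← pow_succ', he])

/-- `f * (1 - f * f) = 0`, and the second factor is a unit. -/
theorem IsLocalRing.eq_zero_of_pow_three_eq {R : Type*} [Ring R] [IsLocalRing R] {f : R}
    (hf : f ^ 3 = f) (h : f ∈ Ring.jacobson R) : f = 0 := by
  have h2 : ¬ IsUnit (f * f) := by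
    intro hu
    obtain ⟨u, hu⟩ := hu
    exact IsLocalRing.mem_ringJacobson_iff.1 h
      (IsLocalRing.isUnit_of_mul_eq_one (z := ↑u⁻¹ * f) (by rw [mul_assoc, ← hu, Units.inv_mul]))
  have hu := (IsLocalRing.isUnit_or_isUnit_of_add_one
    (a := f * f) (b := 1 - f * f) (by abel)).resolve_left h2
  refine hu.mul_right_cancel (b := 1 - f * f) ?_
  rw [zero_mul, mul_sub, mul_one, ← pow_two, ← pow_succ', hf, sub_self]

/-- `(e + 1) * (e - 1) = 0`, and `e + 1` is a unit, being congruent to `2`. -/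
theorem IsLocalRing.eq_one_of_pow_three_eq {R : Type*} [Ring R] [IsLocalRing R] {e : R}
    (h2 : IsUnit (2 : R)) (he : e ^ 3 = e) (h : e - 1 ∈ Ring.jacobson R) : e = 1 := by
  have hsq := pow_two_eq_one_of_isUnit_of_pow_three he
    (IsLocalRing.isUnit_of_sub_mem_ringJacobson h isUnit_one)
  have hu : IsUnit (e + 1) := by
    refine IsLocalRing.isUnit_of_sub_mem_ringJacobson (y := 2) ?_ h2
    rwa [← one_add_one_eq_two, add_sub_add_right_eq_sub]
  refine sub_eq_zero.1 (hu.mul_left_cancel ?_)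
  rw [add_mul, mul_sub, hsq]
  simp

theorem IsLocalRing.eq_neg_one_of_pow_three_eq {R : Type*} [Ring R] [IsLocalRing R] {e : R}
    (h2 : IsUnit (2 : R)) (he : e ^ 3 = e) (h : e + 1 ∈ Ring.jacobson R) : e = -1 := by
  have := IsLocalRing.eq_one_of_pow_three_eq (e := -e) h2
    (by rw [Odd.neg_pow (by decide), he])
    (by rw [← neg_add']; exact neg_mem h)
  rw [← this, neg_neg]

/-- If every element of a nontrivial ring is `0`, `1` or `-1`, the ring is the prime field of
order two or three. -/
theorem nonempty_ringEquiv_zmod_two_or_three {k : Type*} [Ring k] [Nontrivial k]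
    (h : ∀ x : k, x = 0 ∨ x = 1 ∨ x = -1) :
    Nonempty (k ≃+* ZMod 2) ∨ Nonempty (k ≃+* ZMod 3) := by
  by_cases h2 : (2 : k) = 0
  · left
    have : CharP k 2 := (CharP.charP_iff_prime_eq_zero Nat.prime_two).2 (by exact_mod_cast h2)
    refine ⟨(RingEquiv.ofBijective (ZMod.castHom dvd_rfl k)
      ⟨ZMod.castHom_injective k, fun x => ?_⟩).symm⟩
    rcases h x with rfl | rfl | rfl
    exacts [⟨0, map_zero _⟩, ⟨1, map_one _⟩, ⟨-1, by rw [map_neg, map_one]⟩]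
  · right
    have h3 : (3 : k) = 0 := by
      rcases h 2 with h' | h' | h'
      · exact absurd h' h2
      · rw [← one_add_one_eq_two, add_eq_left] at h'
        exact absurd h' one_ne_zero
      · rw [← two_add_one_eq_three, h', neg_add_cancel]
    have : CharP k 3 := (CharP.charP_iff_prime_eq_zero Nat.prime_three).2 (by exact_mod_cast h3)
    refine ⟨(RingEquiv.ofBijective (ZMod.castHom dvd_rfl k)
      ⟨ZMod.castHom_injective k, fun x => ?_⟩).symm⟩
    rcases h x with rfl | rfl | rfl
    exacts [⟨0, map_zero _⟩, ⟨1, map_one _⟩, ⟨-1, by rw [map_neg, map_one]⟩]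

theorem IsLocalRing.quotient_eq_zero_or_one_or_neg_one {R : Type*} [Ring R] [IsLocalRing R]
    (h : IsSDTRing R) (x : R ⧸ Ring.jacobson R) : x = 0 ∨ x = 1 ∨ x = -1 := by
  obtain ⟨a, rfl⟩ := Ideal.Quotient.mk_surjective x
  obtain ⟨e, d, he, hd, -, rfl⟩ := h a
  rw [IsLocalRing.mem_deltaSet_iff] at hd
  rw [map_add, Ideal.Quotient.eq_zero_iff_mem.2 hd, add_zero]
  by_cases hu : IsUnit e
  · have hsq := pow_two_eq_one_of_isUnit_of_pow_three he hu
    by_cases h1 : IsUnit (e - 1)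
    · right; right
      have : e + 1 = 0 := h1.mul_left_cancel (by rw [mul_add, sub_mul, hsq]; simp)
      rw [eq_neg_of_add_eq_zero_left this, map_neg, map_one]
    · right; left
      rw [← map_one (Ideal.Quotient.mk (Ring.jacobson R)), Ideal.Quotient.eq]
      exact IsLocalRing.mem_ringJacobson_iff.2 h1
  · left
    exact Ideal.Quotient.eq_zero_iff_mem.2 (IsLocalRing.mem_ringJacobson_iff.2 hu)

theorem IsLocalRing.isUnit_two_of_quotient_ringEquiv_zmod_three {R : Type*} [Ring R]
    [IsLocalRing R] (φ : R ⧸ Ring.jacobson R ≃+* ZMod 3) : IsUnit (2 : R) := by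
  by_contra h
  have h' := congrArg φ (Ideal.Quotient.eq_zero_iff_mem.2 (IsLocalRing.mem_ringJacobson_iff.2 h))
  rw [map_ofNat, map_ofNat, map_zero] at h'
  exact absurd h' (by decide)

/-! ### Necessity: surjectivity from the corner relation -/

/-- The relations that an SDT decomposition of the upper triangular matrix with diagonal `a`, `b`
and corner `r` imposes force surjectivity of `l_a - r_b`. -/
theorem isBleached_of_exists_tripotents {R : Type*} [Ring R] [IsLocalRing R]
    (H : ∀ a b r : R, ∃ e f x : R, e ^ 3 = e ∧ f ^ 3 = f ∧ a - e ∈ Ring.jacobson R ∧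
      b - f ∈ Ring.jacobson R ∧ a * e = e * a ∧ b * f = f * b ∧
      a * x + r * f = e * r + x * b) : IsBleached R := by
  intro a b ha hb
  constructor
  · intro r
    obtain ⟨e, f, x, he, hf, hae, hbf, hce, -, hx⟩ := H a b r
    have hf0 : f = 0 := IsLocalRing.eq_zero_of_pow_three_eq hf
      (by simpa using sub_mem hb hbf)
    have hsq := pow_two_eq_one_of_isUnit_of_pow_three he
      (IsLocalRing.isUnit_of_sub_mem_ringJacobson (by simpa using neg_mem hae) ha)
    -- With `f = 0` the relation reads `a * x = e * r + x * b`; multiply by `e` on the left.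
    refine ⟨e * x, ?_⟩
    rw [hf0, mul_zero, add_zero] at hx
    rw [leftSubRight_apply, ← mul_assoc, hce, mul_assoc, hx, mul_add, ← mul_assoc e e, hsq, one_mul,
      mul_assoc, add_sub_cancel_right]
  · intro r
    obtain ⟨f, e, x, hf, he, hbf, hae, -, hce, hx⟩ := H b a r
    have hf0 : f = 0 := IsLocalRing.eq_zero_of_pow_three_eq hf
      (by simpa using sub_mem hb hbf)
    have hsq := pow_two_eq_one_of_isUnit_of_pow_three he
      (IsLocalRing.isUnit_of_sub_mem_ringJacobson (by simpa using neg_mem hae) ha)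
    refine ⟨-(x * e), ?_⟩
    rw [hf0, zero_mul, zero_add] at hx
    rw [leftSubRight_apply, neg_mul, mul_assoc x, ← hce, ← mul_assoc x, ← hx, mul_neg, add_mul,
      mul_assoc r, hsq, mul_one, mul_assoc]
    abel

theorem leftSubRight_surjective_of_exists_tripotents {R : Type*} [Ring R] [IsLocalRing R]
    (h2 : IsUnit (2 : R)) {a b : R} (ha : a - 1 ∈ Ring.jacobson R) (hb : b + 1 ∈ Ring.jacobson R)
    (H : ∀ r : R, ∃ e f x : R, e ^ 3 = e ∧ f ^ 3 = f ∧ a - e ∈ Ring.jacobson R ∧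
      b - f ∈ Ring.jacobson R ∧ a * x + r * f = e * r + x * b) :
    Function.Surjective (leftSubRight a b) := by
  intro r
  obtain ⟨u, hu⟩ := h2
  -- For `e = 1`, `f = -1` the relation gives twice the corner entry, so the corner is taken to be
  -- `r / 2`.
  obtain ⟨e, f, x, he, hf, hae, hbf, hx⟩ := H (↑u⁻¹ * r)
  have he1 : e = 1 := IsLocalRing.eq_one_of_pow_three_eq ⟨u, hu⟩ he
    (by simpa using sub_mem ha hae)
  have hf1 : f = -1 := IsLocalRing.eq_neg_one_of_pow_three_eq ⟨u, hu⟩ hf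
    (by simpa [add_comm] using sub_mem hb hbf)
  refine ⟨x, ?_⟩
  rw [he1, hf1] at hx
  have hr : (↑u⁻¹ : R) * r + ↑u⁻¹ * r = r := by
    rw [← two_mul, ← hu, Units.mul_inv_cancel_left]
  rw [mul_neg, mul_one, one_mul] at hx
  rw [leftSubRight_apply]
  calc a * x - x * b = a * x + -(↑u⁻¹ * r) + ↑u⁻¹ * r - x * b := by abel
    _ = ↑u⁻¹ * r + ↑u⁻¹ * r := by rw [hx]; abel
    _ = r := hr

theorem IsBleached.leftSubRight_surjective {R : Type*} [Ring R] [IsLocalRing R]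
    (h : IsBleached R) {a b : R} (hab : ¬ (a ∈ Ring.jacobson R ↔ b ∈ Ring.jacobson R)) :
    Function.Surjective (leftSubRight a b) := by
  by_cases ha : a ∈ Ring.jacobson R
  · have hb : IsUnit b := by
      by_contra hb
      exact hab (iff_of_true ha (IsLocalRing.mem_ringJacobson_iff.2 hb))
    exact (h b a hb ha).2
  · have hb : b ∈ Ring.jacobson R := by
      by_contra hb
      exact hab (iff_of_false ha hb)
    exact (h a b (not_not.1 fun h' => ha (IsLocalRing.mem_ringJacobson_iff.2 h')) hb).1

theorem leftSubRight_surjective_of_neg {R : Type*} [Ring R] {a b : R}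
    (h : Function.Surjective (leftSubRight (-a) (-b))) :
    Function.Surjective (leftSubRight a b) := by
  intro r
  obtain ⟨x, rfl⟩ := h r
  refine ⟨-x, ?_⟩
  simp [leftSubRight_apply]

/-- Well-founded recursion on `μ`: the arbitrary default is never seen by `G`, by `hG`. -/
theorem exists_fixedPoint_of_measure {ι β : Type*} [Nonempty β] (μ : ι → ℕ)
    (G : (ι → β) → ι → β)
    (hG : ∀ f g i, (∀ k, μ k < μ i → f k = g k) → G f i = G g i) :
    ∃ f : ι → β, ∀ i, f i = G f i := by
  classical
  let F : ∀ i, (∀ j, μ j < μ i → β) → β :=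
    fun i rec => G (fun k => if h : μ k < μ i then rec k h else Classical.arbitrary β) i
  let hwf : WellFounded fun i j => μ i < μ j := (measure μ).wf
  refine ⟨hwf.fix F, fun i => ?_⟩
  rw [hwf.fix_eq]
  exact hG _ _ _ fun k hk => dif_pos hk

/-! ### Upper triangular matrices: units and `Δ` -/

namespace upperTriangularRing

variable {n : ℕ} {R : Type*} [Ring R]

theorem apply_eq_zero (A : upperTriangularRing n R) {i j : Fin n} (h : j < i) :
    (A : Matrix (Fin n) (Fin n) R) i j = 0 := A.2 h

@[ext]
theorem ext {A B : upperTriangularRing n R} (h : ∀ i j, A.1 i j = B.1 i j) : A = B :=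
  Subtype.ext (Matrix.ext h)

theorem mul_apply (A B : upperTriangularRing n R) (i j : Fin n) :
    (A * B).1 i j = ∑ k, A.1 i k * B.1 k j := rfl

/-- The upper triangular matrix with the given entries on and above the diagonal. -/
def mk (f : Fin n → Fin n → R) : upperTriangularRing n R :=
  ⟨Matrix.of fun i j => if j < i then 0 else f i j, fun _ _ h => if_pos h⟩

theorem mk_apply (f : Fin n → Fin n → R) {i j : Fin n} (h : i ≤ j) : (mk f).1 i j = f i j :=
  if_neg h.not_gt

/-- The `i`-th diagonal entry, as a ring homomorphism on upper triangular matrices. -/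
def diagHom (i : Fin n) : upperTriangularRing n R →+* R where
  toFun A := A.1 i i
  map_zero' := rfl
  map_one' := Matrix.one_apply_eq i
  map_add' _ _ := rfl
  map_mul' A B := by
    rw [mul_apply]
    refine Finset.sum_eq_single i (fun k _ hk => ?_) (by simp)
    rcases lt_or_gt_of_ne hk with h | h
    · rw [apply_eq_zero A h, zero_mul]
    · rw [apply_eq_zero B h, mul_zero]

theorem diagHom_apply (i : Fin n) (A : upperTriangularRing n R) : diagHom i A = A.1 i i := rfl

/-- Diagonal matrices inside the upper triangular ones. -/
def diagonal : (Fin n → R) →+* upperTriangularRing n R :=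
  (Matrix.diagonalRingHom (Fin n) R).codRestrict _ fun d => Matrix.blockTriangular_diagonal d

@[simp]
theorem diagHom_diagonal (i : Fin n) (d : Fin n → R) : diagHom i (diagonal d) = d i :=
  Matrix.diagonal_apply_eq d i

theorem isNilpotent_of_diagHom_eq_zero {N : upperTriangularRing n R}
    (h : ∀ i, diagHom i N = 0) : IsNilpotent N := by
  -- Each factor `N` pushes the support one superdiagonal up.
  have key : ∀ m : ℕ, ∀ i j : Fin n, (j : ℕ) < i + m → (N ^ m).1 i j = 0 := by
    intro m
    induction m with
    | zero => intro i j hij; exact apply_eq_zero _ (by simpa using hij)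
    | succ m ih =>
      intro i j hij
      rw [pow_succ, mul_apply]
      refine Finset.sum_eq_zero fun k _ => ?_
      rcases lt_trichotomy k j with hk | rfl | hk
      · rw [ih i k (by have := Fin.lt_def.1 hk; omega), zero_mul]
      · rw [← diagHom_apply k N, h, mul_zero]
      · rw [apply_eq_zero N hk, mul_zero]
  exact ⟨n, ext fun i j => key n i j (by omega)⟩

/-- `A` is its diagonal part times a unipotent matrix. -/
theorem isUnit_iff {A : upperTriangularRing n R} : IsUnit A ↔ ∀ i, IsUnit (diagHom i A) := by
  refine ⟨fun h i => h.map _, fun h => ?_⟩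
  have hD : IsUnit (diagonal fun i => diagHom i A) := (Pi.isUnit_iff.2 h).map diagonal
  obtain ⟨D, hD⟩ := hD
  have hN : IsNilpotent ((↑D⁻¹ : upperTriangularRing n R) * A - 1) := by
    refine isNilpotent_of_diagHom_eq_zero fun i => ?_
    have : diagHom i (↑D⁻¹ : upperTriangularRing n R) * diagHom i A = 1 := by
      have := congrArg (diagHom i) D.inv_mul
      rwa [map_mul, hD, diagHom_diagonal, map_one] at this
    rw [map_sub, map_mul, map_one, this, sub_self]
  have := hN.isUnit_one_add
  rw [add_sub_cancel] at this
  exact (Units.isUnit_units_mul _ _).1 this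

theorem mem_deltaSet_iff {A : upperTriangularRing n R} :
    A ∈ DeltaSet (upperTriangularRing n R) ↔ ∀ i, diagHom i A ∈ DeltaSet R := by
  constructor
  · intro h i u hu
    have := (h (diagonal fun _ => u) ((Pi.isUnit_iff.2 fun _ => hu).map diagonal)).map (diagHom i)
    rwa [map_add, diagHom_diagonal] at this
  · intro h u hu
    refine isUnit_iff.2 fun i => ?_
    rw [map_add]
    exact h i _ (isUnit_iff.1 hu i)

theorem isSDTRing_of_pos (hn : 0 < n) (h : IsSDTRing (upperTriangularRing n R)) :
    IsSDTRing R := by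
  intro a
  obtain ⟨e, d, he, hd, hed, hA⟩ := h (diagonal fun _ => a)
  let i : Fin n := ⟨0, hn⟩
  refine ⟨diagHom i e, diagHom i d, by rw [← map_pow, he], mem_deltaSet_iff.1 hd i,
    by rw [← map_mul, hed, map_mul], ?_⟩
  rw [← map_add, ← hA, diagHom_diagonal]

theorem exists_tripotents (h : IsSDTRing (upperTriangularRing n R)) {i j : Fin n} (hij : i < j)
    (a b r : R) : ∃ e f x : R, e ^ 3 = e ∧ f ^ 3 = f ∧ a - e ∈ DeltaSet R ∧ b - f ∈ DeltaSet R ∧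
      a * e = e * a ∧ b * f = f * b ∧ a * x + r * f = e * r + x * b := by
  obtain ⟨E, D, hE, hD, hED, hA⟩ := h (mk fun k l =>
    if k = i then if l = i then a else if l = j then r else 0
    else if k = j ∧ l = j then b else 0)
  set A := mk fun k l : Fin n =>
    if k = i then if l = i then a else if l = j then r else 0
    else if k = j ∧ l = j then b else 0 with hAdef
  have hcomm : A * E = E * A := by rw [hA, add_mul, mul_add, hED]
  have hDA : D = A - E := by rw [hA, add_sub_cancel_left]
  have hii : A.1 i i = a := by rw [mk_apply _ le_rfl]; simp
  have hjj : A.1 j j = b := by rw [mk_apply _ le_rfl]; simp [hij.ne']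
  have hr : A.1 i j = r := by rw [mk_apply _ hij.le]; simp [hij.ne']
  have hrow : ∀ k, k ≠ i → k ≠ j → A.1 i k = 0 := by
    intro k h1 h2
    simp [hAdef, mk, h1, h2]
  have hcol : ∀ k, k ≠ i → k ≠ j → A.1 k j = 0 := by
    intro k h1 h2
    simp [hAdef, mk, h1, h2]
  have hentry := congrArg (fun M => M.1 i j) hcomm
  simp only [mul_apply] at hentry
  rw [Finset.sum_eq_add i j hij.ne (fun k _ hk => by rw [hrow k hk.1 hk.2, zero_mul])
    (by simp) (by simp), Finset.sum_eq_add i j hij.ne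
    (fun k _ hk => by rw [hcol k hk.1 hk.2, mul_zero]) (by simp) (by simp),
    hii, hjj, hr] at hentry
  have hd := mem_deltaSet_iff.1 hD
  refine ⟨diagHom i E, diagHom j E, E.1 i j, by rw [← map_pow, hE], by rw [← map_pow, hE],
    ?_, ?_, ?_, ?_, hentry⟩
  · simpa only [hDA, map_sub, diagHom_apply i A, hii] using hd i
  · simpa only [hDA, map_sub, diagHom_apply j A, hjj] using hd j
  · simpa only [map_mul, diagHom_apply i A, hii] using congrArg (diagHom i) hcomm
  · simpa only [map_mul, diagHom_apply j A, hjj] using congrArg (diagHom j) hcomm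

/-! ### Sufficiency: separating the residue classes -/

/-- The entries of a product above the diagonal, with the two extreme terms split off. -/
theorem mul_apply_of_lt (A B : upperTriangularRing n R) {i j : Fin n} (h : i < j) :
    (A * B).1 i j = A.1 i i * B.1 i j + A.1 i j * B.1 j j
      + ∑ k ∈ Finset.Ioo i j, A.1 i k * B.1 k j := by
  rw [mul_apply, ← Finset.sum_subset (Finset.subset_univ (insert i (insert j (Finset.Ioo i j)))),
    Finset.sum_insert (by simp [h.ne]), Finset.sum_insert (by simp), add_assoc]
  intro k _ hk
  simp only [Finset.mem_insert, Finset.mem_Ioo, not_or, not_and, not_lt] at hk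
  obtain ⟨h1, h2, h3⟩ := hk
  rcases lt_or_gt_of_ne h1 with h' | h'
  · rw [apply_eq_zero A h', zero_mul]
  · rw [apply_eq_zero B (lt_of_le_of_ne (h3 h') (Ne.symm h2)), mul_zero]

/-- If `l_a - r_b` is surjective for all diagonal entries `a`, `b` of `A` in different classes,
then `A` is conjugate by a unitriangular matrix to a matrix that has zero entries between
different classes. -/
theorem exists_unitriangular_conj {κ : Type*} (c : Fin n → κ) (A : upperTriangularRing n R)
    (hA : ∀ i j, c i ≠ c j → Function.Surjective (leftSubRight (A.1 i i) (A.1 j j))) :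
    ∃ P B : upperTriangularRing n R, (∀ i, diagHom i P = 1) ∧ A * P = P * B ∧
      ∀ i j, c i ≠ c j → B.1 i j = 0 := by
  classical
  have hS : ∀ i j, ∃ s : R → R, c i ≠ c j → ∀ r, A.1 i i * s r - s r * A.1 j j = r := by
    intro i j
    by_cases h : c i = c j
    · exact ⟨id, fun h' => absurd h h'⟩
    · choose s hs using hA i j h
      exact ⟨s, fun _ => hs⟩
  choose s hs using hS
  -- With `f = (P, B)`, the `(i, j)` entry of `A * P = P * B` says `A i i * P i j - P i j * A j j +
  -- X = B i j`. Within a class take `P i j = 0`; otherwise solve for `P i j` with `B i j = 0`.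
  let X (f : Fin n × Fin n → R × R) (i j : Fin n) : R :=
    A.1 i j + ∑ k ∈ Finset.Ioo i j, A.1 i k * (f (k, j)).1
      - ∑ k ∈ Finset.Ioo i j, (f (i, k)).1 * (f (k, j)).2
  let G (f : Fin n × Fin n → R × R) (p : Fin n × Fin n) : R × R :=
    if p.1 = p.2 then (1, A.1 p.1 p.2)
    else if c p.1 = c p.2 then (0, X f p.1 p.2)
    else (s p.1 p.2 (-X f p.1 p.2), 0)
  have hX : ∀ f g : Fin n × Fin n → R × R, ∀ p : Fin n × Fin n,
      (∀ q : Fin n × Fin n, (q.2 : ℕ) - q.1 < p.2 - p.1 → f q = g q) →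
      X f p.1 p.2 = X g p.1 p.2 := by
    rintro f g ⟨i, j⟩ h
    have h1 : ∀ k ∈ Finset.Ioo i j, f (k, j) = g (k, j) := by
      intro k hk
      refine h (k, j) ?_
      simp only [Finset.mem_Ioo, Fin.lt_def] at hk
      dsimp only
      omega
    have h2 : ∀ k ∈ Finset.Ioo i j, f (i, k) = g (i, k) := by
      intro k hk
      refine h (i, k) ?_
      simp only [Finset.mem_Ioo, Fin.lt_def] at hk
      dsimp only
      omega
    simp only [X]
    congr 1
    · congr 1
      exact Finset.sum_congr rfl fun k hk => by rw [h1 k hk]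
    · exact Finset.sum_congr rfl fun k hk => by rw [h1 k hk, h2 k hk]
  -- Below the diagonal the truncated difference is `0` and the sums are empty; `mk` discards those
  -- values.
  obtain ⟨f, hf⟩ := exists_fixedPoint_of_measure
    (fun p : Fin n × Fin n => (p.2 : ℕ) - p.1) G (by
      intro f g p h
      simp only [G, hX f g p h])
  have hdiag : ∀ i, f (i, i) = (1, A.1 i i) := fun i => by rw [hf]; exact if_pos rfl
  refine ⟨mk fun i j => (f (i, j)).1, mk fun i j => (f (i, j)).2, fun i => ?_, ?_, ?_⟩
  · rw [diagHom_apply, mk_apply _ le_rfl, hdiag]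
  · ext i j
    rcases lt_trichotomy i j with h | rfl | h
    · rw [mul_apply_of_lt _ _ h, mul_apply_of_lt _ _ h]
      simp only [mk_apply _ le_rfl, mk_apply _ h.le, hdiag]
      have h1 : ∑ k ∈ Finset.Ioo i j, A.1 i k * (mk fun i j => (f (i, j)).1).1 k j
          = ∑ k ∈ Finset.Ioo i j, A.1 i k * (f (k, j)).1 :=
        Finset.sum_congr rfl fun k hk => by rw [mk_apply _ (Finset.mem_Ioo.1 hk).2.le]
      have h2 : ∑ k ∈ Finset.Ioo i j,
            (mk fun i j => (f (i, j)).1).1 i k * (mk fun i j => (f (i, j)).2).1 k j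
          = ∑ k ∈ Finset.Ioo i j, (f (i, k)).1 * (f (k, j)).2 :=
        Finset.sum_congr rfl fun k hk => by
          rw [mk_apply _ (Finset.mem_Ioo.1 hk).1.le, mk_apply _ (Finset.mem_Ioo.1 hk).2.le]
      rw [h1, h2]
      by_cases hc : c i = c j
      · have hfij : f (i, j) = (0, X f i j) := by
          rw [hf]
          simp only [G, h.ne, hc, if_true, if_false]
        rw [hfij]
        simp only [X, mul_zero, zero_mul, mul_one, one_mul]
        abel
      · have hfij : f (i, j) = (s i j (-X f i j), 0) := by
          rw [hf]
          simp only [G, h.ne, hc, if_false]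
        rw [hfij]
        have := eq_add_of_sub_eq (hs i j hc (-X f i j))
        dsimp only
        rw [this]
        simp only [X, mul_zero, mul_one]
        abel
    · simp only [← diagHom_apply, map_mul]
      simp only [diagHom_apply, mk_apply _ le_rfl, hdiag, mul_one, one_mul]
    · rw [apply_eq_zero _ h, apply_eq_zero _ h]
  · intro i j hc
    by_cases h : j < i
    · exact apply_eq_zero _ h
    · rw [mk_apply _ (not_lt.1 h), hf]
      have hne : i ≠ j := fun h => hc (congrArg c h)
      simp only [G, hne, hc, if_false]

/-- If a ring has residue ring `{0, 1, -1}` and `l_a - r_b` is surjective whenever `a` and `b`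
have different residues, then its upper triangular matrix rings are SDT. -/
theorem isSDTRing_of_surjective {k : Type*} [Ring k] (φ : R →+* k)
    (hk : ∀ x : k, x = 0 ∨ x = 1 ∨ x = -1) (hker : ∀ x, φ x = 0 → x ∈ DeltaSet R)
    (hsurj : ∀ a b, φ a ≠ φ b → Function.Surjective (leftSubRight a b)) :
    IsSDTRing (upperTriangularRing n R) := by
  have hlift : ∀ x : k, ∃ t : R, φ t = x ∧ t ^ 3 = t ∧ ∀ y, Commute t y := by
    intro x
    rcases hk x with rfl | rfl | rfl
    · exact ⟨0, map_zero φ, by simp, Commute.zero_left⟩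
    · exact ⟨1, map_one φ, by simp, Commute.one_left⟩
    · exact ⟨-1, by simp, by rw [Odd.neg_pow (by decide), one_pow],
        fun y => (Commute.one_left y).neg_left⟩
  choose t ht ht3 htc using hlift
  intro A
  let c : Fin n → k := fun i => φ (A.1 i i)
  obtain ⟨P, B, hP, hAP, hB⟩ := exists_unitriangular_conj c A fun i j h => hsurj _ _ h
  obtain ⟨u, rfl⟩ : IsUnit P := isUnit_iff.2 fun i => by rw [hP]; exact isUnit_one
  let T : upperTriangularRing n R := diagonal fun i => t (c i)
  have hT3 : T ^ 3 = T := by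
    simp only [T, ← map_pow]
    congr 1
    ext i
    exact ht3 _
  -- `T` is a central scalar on each class, and `B` does not mix classes.
  have hTB : T * B = B * T := by
    ext i j
    change (Matrix.diagonal (fun i => t (c i)) * B.1 : Matrix (Fin n) (Fin n) R) i j
      = (B.1 * Matrix.diagonal fun i => t (c i) : Matrix (Fin n) (Fin n) R) i j
    rw [Matrix.diagonal_mul, Matrix.mul_diagonal]
    by_cases h : c i = c j
    · rw [h, (htc _ _).eq]
    · rw [hB i j h, mul_zero, zero_mul]
  have hA : A = u * B * ↑u⁻¹ := by rw [← hAP, Units.mul_inv_cancel_right]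
  have hcomm : u * T * ↑u⁻¹ * A = A * (u * T * ↑u⁻¹) := by
    rw [hA]
    simp only [mul_assoc, Units.inv_mul_cancel_left]
    rw [← mul_assoc T, hTB, mul_assoc]
  refine ⟨u * T * ↑u⁻¹, A - u * T * ↑u⁻¹, by rw [Units.conj_pow, hT3], ?_,
    by rw [mul_sub, sub_mul, hcomm], by rw [add_sub_cancel]⟩
  refine mem_deltaSet_iff.2 fun i => hker _ ?_
  have hinv : diagHom i (↑u⁻¹ : upperTriangularRing n R) = 1 := by
    have := congrArg (diagHom i) u.mul_inv
    rwa [map_mul, hP, one_mul, map_one] at this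
  rw [map_sub, map_mul, map_mul, hP, hinv, one_mul, mul_one, diagHom_diagonal, map_sub, ht,
    diagHom_apply, sub_self]

end upperTriangularRing

theorem theorem4p4 (R : Type*) [Ring R] [IsLocalRing R] (n : ℕ) (hn : 2 < n) :
    IsSDTRing (upperTriangularRing n R) ↔
      (IsBleached R ∧ Nonempty (R ⧸ Ring.jacobson R ≃+* ZMod 2)) ∨
      (IsBleached R ∧ Nonempty (R ⧸ Ring.jacobson R ≃+* ZMod 3) ∧
        ∀ a b : R, a - 1 ∈ DeltaSet R → b + 1 ∈ DeltaSet R →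
          Function.Surjective (leftSubRight a b)) := by
  constructor
  · intro h
    have : Nontrivial (R ⧸ Ring.jacobson R) := Ideal.Quotient.nontrivial_iff.2 fun htop =>
      IsLocalRing.mem_ringJacobson_iff.1 (htop ▸ Submodule.mem_top : (1 : R) ∈ _) isUnit_one
    have H := upperTriangularRing.exists_tripotents h
      (i := ⟨0, by omega⟩) (j := ⟨1, by omega⟩) (by simp)
    simp only [IsLocalRing.mem_deltaSet_iff] at H ⊢
    have hbl := isBleached_of_exists_tripotents H
    rcases nonempty_ringEquiv_zmod_two_or_three (IsLocalRing.quotient_eq_zero_or_one_or_neg_one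
      (upperTriangularRing.isSDTRing_of_pos (by omega) h)) with h2 | ⟨⟨φ⟩⟩
    · exact Or.inl ⟨hbl, h2⟩
    · refine Or.inr ⟨hbl, ⟨φ⟩, fun a b ha hb => leftSubRight_surjective_of_exists_tripotents
        (IsLocalRing.isUnit_two_of_quotient_ringEquiv_zmod_three φ) ha hb fun r => ?_⟩
      obtain ⟨e, f, x, he, hf, hae, hbf, -, -, hx⟩ := H a b r
      exact ⟨e, f, x, he, hf, hae, hbf, hx⟩
  · intro h
    -- Bleachedness settles a unit against a nonunit, so only two units with distinct residues
    -- remain: none modulo `2`, the pairs `(1, -1)` and `(-1, 1)` modulo `3`.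
    have key : ∀ p : ℕ, ∀ φ : R ⧸ Ring.jacobson R ≃+* ZMod p,
        (∀ x : ZMod p, x = 0 ∨ x = 1 ∨ x = -1) →
        (∀ a b : R, a ∉ Ring.jacobson R → b ∉ Ring.jacobson R →
          φ (Ideal.Quotient.mk _ a) ≠ φ (Ideal.Quotient.mk _ b) →
          Function.Surjective (leftSubRight a b)) →
        IsBleached R → IsSDTRing (upperTriangularRing n R) := by
      intro p φ hp hs hbl
      refine upperTriangularRing.isSDTRing_of_surjective
        (φ.toRingHom.comp (Ideal.Quotient.mk (Ring.jacobson R))) hp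
        (fun x hx => IsLocalRing.mem_deltaSet_iff.2 (Ideal.Quotient.eq_zero_iff_mem.1
          ((map_eq_zero_iff φ φ.injective).1 hx))) fun a b hab => ?_
      by_cases h : a ∈ Ring.jacobson R ↔ b ∈ Ring.jacobson R
      · by_cases ha : a ∈ Ring.jacobson R
        · refine absurd (congrArg φ ?_) hab
          rw [Ideal.Quotient.eq_zero_iff_mem.2 ha, Ideal.Quotient.eq_zero_iff_mem.2 (h.1 ha)]
        · exact hs a b ha (fun hb => ha (h.2 hb)) hab
      · exact hbl.leftSubRight_surjective h
    have hne : ∀ p : ℕ, ∀ φ : R ⧸ Ring.jacobson R ≃+* ZMod p, ∀ a : R, a ∉ Ring.jacobson R →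
        φ (Ideal.Quotient.mk _ a) ≠ 0 := fun p φ a ha h =>
      ha (Ideal.Quotient.eq_zero_iff_mem.1 ((map_eq_zero_iff φ φ.injective).1 h))
    have hone : ∀ p : ℕ, ∀ φ : R ⧸ Ring.jacobson R ≃+* ZMod p, ∀ a : R,
        φ (Ideal.Quotient.mk _ a) = 1 → a - 1 ∈ DeltaSet R := fun p φ a h =>
      IsLocalRing.mem_deltaSet_iff.2 (Ideal.Quotient.eq.1 (φ.injective (by rw [h, map_one, map_one])))
    have hneg : ∀ p : ℕ, ∀ φ : R ⧸ Ring.jacobson R ≃+* ZMod p, ∀ a : R,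
        φ (Ideal.Quotient.mk _ a) = -1 → a + 1 ∈ DeltaSet R := fun p φ a h => by
      have := neg_mem_deltaSet (hone p φ (-a) (by rw [map_neg, map_neg, h, neg_neg]))
      rwa [← neg_add', neg_neg] at this
    rcases h with ⟨hbl, ⟨φ⟩⟩ | ⟨hbl, ⟨φ⟩, hs⟩
    · refine key 2 φ (by decide) (fun a b ha hb hab => absurd ?_ hab) hbl
      have h2 : ∀ x y : ZMod 2, x ≠ 0 → y ≠ 0 → x = y := by decide
      exact h2 _ _ (hne 2 φ a ha) (hne 2 φ b hb)
    · refine key 3 φ (by decide) (fun a b ha hb hab => ?_) hbl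
      have h3 : ∀ x y : ZMod 3, x ≠ 0 → y ≠ 0 → x ≠ y → x = 1 ∧ y = -1 ∨ x = -1 ∧ y = 1 := by
        decide
      rcases h3 _ _ (hne 3 φ a ha) (hne 3 φ b hb) hab with ⟨ha, hb⟩ | ⟨ha, hb⟩
      · exact hs a b (hone 3 φ a ha) (hneg 3 φ b hb)
      · refine leftSubRight_surjective_of_neg (hs (-a) (-b) ?_ ?_)
        · exact hone 3 φ _ (by rw [map_neg, map_neg, ha, neg_neg])
        · exact hneg 3 φ _ (by rw [map_neg, map_neg, hb])
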